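/- Let $n,m,n_q\in\mathbb N$ and $T\ge 0$. Write $\mathbb S^k_{++}$ for the symmetric positive definite $k\times k$ real matrices, $M^{1/2}$ for the positive semidefinite square root of a positive semidefinite matrix $M$, and $\mathcal E(q,Q)=\{x : \langle x-q,Q^{-1}(x-q)\rangle\le 1\}$ for $Q$ positive definite. Let $A:[0,T]\to\mathbb R^{n\times n}$ and $B:[0,T]\to\mathbb R^{n\times m}$ be continuous, $p\in\mathbb R^m$, $P\in\mathbb S^m_{++}$, $x_e\in\mathbb R^n$, $X_e\in\mathbb S^n_{++}$, and consider, for $t\in[0,T]$, the linear time-varying system $$\dot x(s)=A(s)x(s)+B(s)u(s)\ \text{ for a.e. } s\in(t,T),\qquad u(s)\in\mathbb U=\mathcal E(p,P),$$ with terminal set $\mathcal X=\mathcal E(x_e,X_e)$; controls are measurable functions $u:[t,T]\to\mathbb U$, and solutions are absolutely continuous. The backwards reachable set $\mathcal G(t)$ is the set of all $x\in\mathbb R^n$ for which some control $u$ on $[t,T]$ steers the solution starting at $x$ at time $t$ into $\mathcal X$ at time $T$. For $i=1,\dots,n_q$ let $S_i:[0,T]\to\mathbb R^{n\times n}$ be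 continuous with orthogonal values, and put, for $Q\in\mathbb S^n_{++}$, $$\mathcal Q_\star(t,Q)=Q^{-1/2}B(t)PB^T(t)Q^{-1/2},\qquad \underline{\mathcal R}_i(t,Q)=Q^{1/2}\big(\mathcal Q_\star^{1/2}(t,Q)S_i(t)+S_i^T(t)\mathcal Q_\star^{1/2}(t,Q)\big)Q^{1/2}.$$ Suppose that absolutely continuous $q_i:[0,T]\to\mathbb R^n$ and $Q_i:[0,T]\to\mathbb S^n_{++}$ satisfy, for a.e. $t\in(0,T)$, $$\dot q_i=A q_i+Bp,\qquad \dot Q_i=AQ_i+Q_iA^T-\underline{\mathcal R}_i(t,Q_i),\qquad q_i(T)=x_e,\quad Q_i(T)=X_e .$$ Set $\underline{\mathcal G}(t)=\bigcup_{i=1}^{n_q}\mathcal E(q_i(t),Q_i(t))$. Then: (a) $\underline{\mathcal G}(t)\subseteq\mathcal G(t)$ for all $t\in[0,T]$. (b) Let $t\in[0,T]$, $i\in\{1,\dots,n_q\}$, and let $x^\star$ be a solution of the system on $[t,T]$ for some control $u^\star:[t,T]\to\mathbb U$, with $x^\star(T)\in\mathcal X$. Put $\hat w_i(s)=Q_i^{-1/2}(s)(x^\star(s)-q_i(s))$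 and $\mathcal Q_{i,\star}(s)=\mathcal Q_\star(s,Q_i(s))$, and suppose that $$\frac{S_i(s)\hat w_i(s)}{\|\hat w_i(s)\|_2}=\frac{\mathcal Q_{i,\star}^{1/2}(s)\hat w_i(s)}{\|\mathcal Q_{i,\star}^{1/2}(s)\hat w_i(s)\|_2}$$ for all $s\in[t,T]$ with $\mathcal Q_{i,\star}^{1/2}(s)\hat w_i(s)\ne0$. Then $x^\star(s)\in\mathcal E(q_i(s),Q_i(s))\subseteq\underline{\mathcal G}(s)$ for all $s\in[t,T]$; in particular this holds at $s=t$. -/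

import Mathlib

open Set MeasureTheory
open scoped Matrix

noncomputable section

/-- The Euclidean norm `‖v‖₂` of a coordinate vector (the bare type `Fin n → ℝ` carries the sup
norm, which is used below only for its topology and for absolute continuity). -/
def norm2 {n : ℕ} (v : Fin n → ℝ) : ℝ := ‖WithLp.toLp 2 v‖

/-- `x` is a (Carathéodory) solution of `x'(s) = F(s, x(s))` for a.e. `s ∈ (a, b)`:
it is absolutely continuous on `[a, b]` and satisfies the equation almost everywhere. -/
def IsSolutionOn {E : Type*} [NormedAddCommGroup E] [NormedSpace ℝ E]
    (F : ℝ → E → E) (a b : ℝ) (x : ℝ → E) : Prop :=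
  AbsolutelyContinuousOnInterval x a b ∧
    ∀ᵐ s ∂volume, s ∈ Ioo a b → HasDerivAt x (F s (x s)) s

/-- The admissible controls on `[t, T]`: measurable functions `[t, T] → U`. -/
def admissibleControls {m : ℕ} (U : Set (Fin m → ℝ)) (t T : ℝ) : Set (ℝ → Fin m → ℝ) :=
  {u | Measurable ((Icc t T).domRestrict u) ∧ ∀ s ∈ Icc t T, u s ∈ U}

/-- `x` is a trajectory on `[t, T]` of `x'(s) = f(s, x(s), u(s))` under the control `u`. -/
def IsTrajectory {n m : ℕ} (f : ℝ → (Fin n → ℝ) → (Fin m → ℝ) → (Fin n → ℝ)) (t T : ℝ)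
    (u : ℝ → Fin m → ℝ) (x : ℝ → Fin n → ℝ) : Prop :=
  IsSolutionOn (fun s y => f s y (u s)) t T x

/-- The backwards reachable set at time `t`: the states from which some admissible control on
`[t, T]` leads the system into `X` at time `T`. -/
def backwardReachableSet {n m : ℕ} (f : ℝ → (Fin n → ℝ) → (Fin m → ℝ) → (Fin n → ℝ))
    (U : Set (Fin m → ℝ)) (X : Set (Fin n → ℝ)) (T t : ℝ) : Set (Fin n → ℝ) :=
  {x₀ | ∃ u ∈ admissibleControls U t T, ∃ x : ℝ → Fin n → ℝ,
    IsTrajectory f t T u x ∧ x t = x₀ ∧ x T ∈ X}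

/-- The vector field `(s, x, u) ↦ A(s) x + B(s) u` of a linear time-varying system. -/
def ltvField {n m : ℕ} (A : ℝ → Matrix (Fin n) (Fin n) ℝ) (B : ℝ → Matrix (Fin n) (Fin m) ℝ)
    (s : ℝ) (x : Fin n → ℝ) (u : Fin m → ℝ) : Fin n → ℝ :=
  A s *ᵥ x + B s *ᵥ u

/-- The ellipsoid with centre `q` and (positive definite) shape `Q`. -/
def ellipsoid {n : ℕ} (q : Fin n → ℝ) (Q : Matrix (Fin n) (Fin n) ℝ) : Set (Fin n → ℝ) :=
  {x | (x - q) ⬝ᵥ (Q⁻¹ *ᵥ (x - q)) ≤ 1}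

section MatrixRoot

open scoped MatrixOrder

/-- The positive semidefinite square root of a positive semidefinite matrix. -/
def matSqrt {n : ℕ} (Q : Matrix (Fin n) (Fin n) ℝ) : Matrix (Fin n) (Fin n) ℝ := CFC.sqrt Q

theorem matSqrt_posSemidef {n : ℕ} (Q : Matrix (Fin n) (Fin n) ℝ) :
    (matSqrt Q).PosSemidef :=
  Matrix.nonneg_iff_posSemidef.mp (CFC.sqrt_nonneg Q)

theorem matSqrt_mul_self {n : ℕ} {Q : Matrix (Fin n) (Fin n) ℝ} (hQ : Q.PosSemidef) :
    matSqrt Q * matSqrt Q = Q :=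
  CFC.sqrt_mul_sqrt_self Q (Matrix.nonneg_iff_posSemidef.mpr hQ)

end MatrixRoot

/-- `𝒬⋆ = Q^{-1/2} B P Bᵀ Q^{-1/2}` for one value `B` of the input matrix. -/
def qStar {n m : ℕ} (B : Matrix (Fin n) (Fin m) ℝ) (P : Matrix (Fin m) (Fin m) ℝ)
    (Q : Matrix (Fin n) (Fin n) ℝ) : Matrix (Fin n) (Fin n) ℝ :=
  (matSqrt Q)⁻¹ * B * P * Bᵀ * (matSqrt Q)⁻¹

/-- `R = Q^{1/2} (𝒬⋆^{1/2} S + Sᵀ 𝒬⋆^{1/2}) Q^{1/2}` for one value `B`, `S` of the input matrix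
and of the orthogonal matrix. -/
def rUnder {n m : ℕ} (B : Matrix (Fin n) (Fin m) ℝ) (P : Matrix (Fin m) (Fin m) ℝ)
    (S Q : Matrix (Fin n) (Fin n) ℝ) : Matrix (Fin n) (Fin n) ℝ :=
  matSqrt Q * (matSqrt (qStar B P Q) * S + Sᵀ * matSqrt (qStar B P Q)) * matSqrt Q

section EllipsoidFlow

open scoped Matrix.Norms.L2Operator

/-- `(q, Q)` solves, on `[0, T]`, the final value problem
`q' = A q + B p`, `Q' = A Q + Q Aᵀ - R(t, Q)`, `q(T) = xe`, `Q(T) = Xe`,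
with `Q(t)` positive definite for all `t ∈ [0, T]`. -/
structure IsEllipsoidFlow {n m : ℕ} (T : ℝ) (A : ℝ → Matrix (Fin n) (Fin n) ℝ)
    (B : ℝ → Matrix (Fin n) (Fin m) ℝ) (p : Fin m → ℝ) (P : Matrix (Fin m) (Fin m) ℝ)
    (xe : Fin n → ℝ) (Xe : Matrix (Fin n) (Fin n) ℝ) (S : ℝ → Matrix (Fin n) (Fin n) ℝ)
    (q : ℝ → Fin n → ℝ) (Q : ℝ → Matrix (Fin n) (Fin n) ℝ) : Prop where
  center_ode : IsSolutionOn (fun t y => A t *ᵥ y + B t *ᵥ p) 0 T q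
  shape_ode : IsSolutionOn (fun t Y => A t * Y + Y * (A t)ᵀ - rUnder (B t) P (S t) Y) 0 T Q
  center_final : q T = xe
  shape_final : Q T = Xe
  shape_posDef : ∀ t ∈ Icc 0 T, (Q t).PosDef

end EllipsoidFlow

/-- The normalised position `Q^{-1/2} (x - q)`. -/
def wHat {n : ℕ} (q : Fin n → ℝ) (Q : Matrix (Fin n) (Fin n) ℝ) (x : Fin n → ℝ) : Fin n → ℝ :=
  (matSqrt Q)⁻¹ *ᵥ (x - q)

/-- The orthogonal matrices `S(s)` are aligned with the curve `x` on `[t, T]`: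
`S ŵ / ‖ŵ‖₂ = 𝒬⋆^{1/2} ŵ / ‖𝒬⋆^{1/2} ŵ‖₂` at every time where `𝒬⋆^{1/2} ŵ ≠ 0`. -/
def IsAligned {n m : ℕ} (t T : ℝ) (B : ℝ → Matrix (Fin n) (Fin m) ℝ)
    (P : Matrix (Fin m) (Fin m) ℝ) (S : ℝ → Matrix (Fin n) (Fin n) ℝ)
    (q : ℝ → Fin n → ℝ) (Q : ℝ → Matrix (Fin n) (Fin n) ℝ) (x : ℝ → Fin n → ℝ) : Prop :=
  ∀ s ∈ Icc t T, matSqrt (qStar (B s) P (Q s)) *ᵥ wHat (q s) (Q s) (x s) ≠ 0 →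
    (norm2 (wHat (q s) (Q s) (x s)))⁻¹ • (S s *ᵥ wHat (q s) (Q s) (x s)) =
      (norm2 (matSqrt (qStar (B s) P (Q s)) *ᵥ wHat (q s) (Q s) (x s)))⁻¹ •
        (matSqrt (qStar (B s) P (Q s)) *ᵥ wHat (q s) (Q s) (x s))

/-- The union at time `t` of finitely many moving ellipsoids. -/
def ellipsoidUnion {n N : ℕ} (q : Fin N → ℝ → Fin n → ℝ)
    (Q : Fin N → ℝ → Matrix (Fin n) (Fin n) ℝ) (t : ℝ) : Set (Fin n → ℝ) :=
  ⋃ i, ellipsoid (q i t) (Q i t)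

end

/-! Everything rests on `V(s) = ⟨x - q, Q⁻¹(x - q)⟩`, which is at most 1 exactly when `x(s)` lies in
the moving ellipsoid. Write `ŵ = Q^{-1/2}(x - q)` and `H = 𝒬⋆^{1/2}`. Along a trajectory the terms
in `A` cancel and almost everywhere `V' = 2⟨Q⁻¹(x - q), B(u - p)⟩ + 2⟨Hŵ, Sŵ⟩`
(`IsEllipsoidFlow.ae_hasDerivAt_quadraticForm`).

(a) A control with `B(u - p) = -Q^{1/2} H S ŵ` makes `V` constant, so a start in the ellipsoid ends
in the terminal set. The closed loop is linear in `x - q`, hence globally solvable. With `C =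
Q^{-1/2} B P^{1/2}` one has `𝒬⋆ = C Cᵀ`, so the minimal norm solution of `C w = H S ŵ` has `‖w‖ ≤
‖Sŵ‖ = ‖ŵ‖ ≤ 1`, and `u = p - P^{1/2} w` is admissible. Measurability in time comes from Tikhonov
regularisation (`exists_measurable_minimal_solution`).

(b) Any admissible input contributes at least `-2‖Hŵ‖` (`abs_dotProduct_input_le`), while alignment
turns the other term into `2‖ŵ‖‖Hŵ‖`. Hence `V' ≥ 0` wherever `V > 1`, and `V(T) ≤ 1` propagates
backwards (`le_of_ae_deriv_nonneg_of_gt`). -/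

/-! ### Absolutely continuous functions and monotonicity from a.e. derivatives. -/

section AbsoluteContinuity

namespace AbsolutelyContinuousOnInterval

variable {X Y : Type*} [PseudoMetricSpace X] [PseudoMetricSpace Y]

/-- A function whose increments are controlled by those of an absolutely continuous function is
absolutely continuous. -/
theorem of_dist_le {f : ℝ → X} {g : ℝ → Y} {a b C : ℝ}
    (hg : AbsolutelyContinuousOnInterval g a b)
    (h : ∀ x ∈ uIcc a b, ∀ y ∈ uIcc a b, dist (f x) (f y) ≤ C * dist (g x) (g y)) :
    AbsolutelyContinuousOnInterval f a b := by
  have h0 := Filter.Tendsto.const_mul C hg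
  rw [mul_zero] at h0
  refine tendsto_of_tendsto_of_tendsto_of_le_of_le' tendsto_const_nhds h0
    (Filter.Eventually.of_forall fun E => Finset.sum_nonneg fun _ _ => dist_nonneg) ?_
  have hE : ∀ᶠ E in totalLengthFilter ⊓ Filter.principal (disjWithin a b),
      E ∈ disjWithin a b := Filter.mem_inf_of_right (Filter.mem_principal_self _)
  filter_upwards [hE] with E hE
  rw [Finset.mul_sum]
  exact Finset.sum_le_sum fun i hi => h _ (hE.1 i hi).1 _ (hE.1 i hi).2

theorem clm_comp {E F : Type*} [NormedAddCommGroup E] [NormedSpace ℝ E] [NormedAddCommGroup F]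
    [NormedSpace ℝ F] (L : E →L[ℝ] F) {f : ℝ → E} {a b : ℝ}
    (hf : AbsolutelyContinuousOnInterval f a b) :
    AbsolutelyContinuousOnInterval (fun x => L (f x)) a b :=
  hf.of_dist_le fun _ _ _ _ => L.dist_le_opNorm _ _

theorem sum {ι : Type*} {F : Type*} [SeminormedAddCommGroup F] (s : Finset ι) {f : ι → ℝ → F}
    {a b : ℝ} (hf : ∀ i ∈ s, AbsolutelyContinuousOnInterval (f i) a b) :
    AbsolutelyContinuousOnInterval (fun x => ∑ i ∈ s, f i x) a b := by
  classical
  induction s using Finset.induction_on with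
  | empty =>
    exact ((LipschitzWith.const (0 : F)).lipschitzOnWith (s := uIcc a b)
      ).absolutelyContinuousOnInterval
  | insert i s hi ih =>
    simp only [Finset.sum_insert hi]
    exact (hf i (Finset.mem_insert_self _ _)).add
      (ih fun j hj => hf j (Finset.mem_insert_of_mem hj))

theorem le_of_ae_deriv_nonneg {f : ℝ → ℝ} {a b : ℝ} (hab : a ≤ b)
    (hf : AbsolutelyContinuousOnInterval f a b)
    (hf' : ∀ᵐ s ∂volume, s ∈ Ioo a b → 0 ≤ deriv f s) : f a ≤ f b := by
  rw [← sub_nonneg, ← hf.integral_deriv_eq_sub]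
  refine intervalIntegral.integral_nonneg_of_ae_restrict hab ?_
  rw [Measure.restrict_congr_set Ioo_ae_eq_Icc.symm]
  exact (ae_restrict_iff' measurableSet_Ioo).2 hf'

theorem eq_of_ae_deriv_eq_zero {f : ℝ → ℝ} {a b : ℝ} (hab : a ≤ b)
    (hf : AbsolutelyContinuousOnInterval f a b)
    (hf' : ∀ᵐ s ∂volume, s ∈ Ioo a b → deriv f s = 0) : f a = f b := by
  refine le_antisymm (hf.le_of_ae_deriv_nonneg hab (hf'.mono fun s hs h => (hs h).ge)) ?_
  have := hf.neg.le_of_ae_deriv_nonneg hab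
    (hf'.mono fun s hs h => by rw [deriv.neg, hs h, neg_zero])
  simpa using this

/-- If an absolutely continuous function is nondecreasing wherever it exceeds `c` and is at most
`c` at the right end point, then it is at most `c` everywhere. -/
theorem le_of_ae_deriv_nonneg_of_gt {f : ℝ → ℝ} {a b c : ℝ} (hab : a ≤ b)
    (hf : AbsolutelyContinuousOnInterval f a b) (hb : f b ≤ c)
    (hf' : ∀ᵐ s ∂volume, s ∈ Ioo a b → c < f s → 0 ≤ deriv f s) : f a ≤ c := by
  have hcont : ContinuousOn f (Icc a b) := by simpa [uIcc_of_le hab] using hf.continuousOn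
  -- `d = sInf K` is the first time with `f ≤ c`. Before `d` the function exceeds `c`, hence is
  -- nondecreasing, so `f a ≤ f d ≤ c`.
  set K := Icc a b ∩ f ⁻¹' Iic c
  have hK : IsCompact K :=
    isCompact_Icc.of_isClosed_subset (hcont.preimage_isClosed_of_isClosed isClosed_Icc isClosed_Iic)
      inter_subset_left
  have hmem : sInf K ∈ K := hK.sInf_mem ⟨b, right_mem_Icc.2 hab, hb⟩
  set d := sInf K
  refine le_trans ?_ hmem.2
  refine (hf.mono ?_).le_of_ae_deriv_nonneg hmem.1.1 ?_
  · rw [uIcc_of_le hmem.1.1, uIcc_of_le hab]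
    exact Icc_subset_Icc_right hmem.1.2
  · filter_upwards [hf'] with s hs hsd
    refine hs ⟨hsd.1, hsd.2.trans_le hmem.1.2⟩ ?_
    by_contra! hle
    exact hsd.2.not_ge (csInf_le hK.bddBelow ⟨⟨hsd.1.le, hsd.2.le.trans hmem.1.2⟩, hle⟩)

end AbsolutelyContinuousOnInterval

end AbsoluteContinuity

/-! ### Global solvability of linear differential equations. -/

section LinearODE

/-- Coordinatewise truncation to `[-R, R]`. -/
def clampPi {ι : Type*} (R : ℝ) (x : ι → ℝ) : ι → ℝ := fun i => max (-R) (min R (x i))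

theorem lipschitzWith_clampPi {ι : Type*} [Fintype ι] (R : ℝ) :
    LipschitzWith 1 (clampPi R : (ι → ℝ) → ι → ℝ) := by
  refine LipschitzWith.of_dist_le_mul fun x y => ?_
  rw [NNReal.coe_one, one_mul, dist_pi_le_iff dist_nonneg]
  intro i
  refine le_trans ?_ (dist_le_pi_dist x y i)
  simpa [clampPi] using
    ((LipschitzWith.id.const_min R).const_max (-R)).dist_le_mul (x i) (y i)

theorem clampPi_eq_self {ι : Type*} [Fintype ι] {R : ℝ} {x : ι → ℝ} (h : ‖x‖ ≤ R) :
    clampPi R x = x := by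
  funext i
  have hi := abs_le.1 ((norm_le_pi_norm x i).trans h)
  simp [clampPi, hi.1, hi.2]

theorem norm_clampPi_le {ι : Type*} [Fintype ι] {R : ℝ} (hR : 0 ≤ R) (x : ι → ℝ) :
    ‖clampPi R x‖ ≤ R := by
  refine (pi_norm_le_iff_of_nonneg hR).2 fun i => abs_le.2 ⟨le_max_left _ _, ?_⟩
  exact max_le (by linarith) (min_le_left _ _)

theorem norm_clampPi_le_norm {ι : Type*} [Fintype ι] {R : ℝ} (hR : 0 ≤ R) (x : ι → ℝ) :
    ‖clampPi R x‖ ≤ ‖x‖ := by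
  have h0 : clampPi R (0 : ι → ℝ) = 0 := clampPi_eq_self (by simpa using hR)
  simpa [h0] using (lipschitzWith_clampPi R).dist_le_mul x 0

/-- Global existence for linear ordinary differential equations with continuous coefficients. -/
theorem exists_linear_ode_solution {ι : Type*} [Fintype ι]
    {F : ℝ → (ι → ℝ) →L[ℝ] (ι → ℝ)} {a b : ℝ} (hab : a ≤ b) (hF : ContinuousOn F (Icc a b))
    (x₀ : ι → ℝ) :
    ∃ x : ℝ → ι → ℝ, x a = x₀ ∧ ∀ s ∈ Icc a b, HasDerivWithinAt x (F s (x s)) (Icc a b) s := by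
  obtain ⟨C, hC⟩ := isCompact_Icc.exists_bound_of_continuousOn hF
  have hC0 : 0 ≤ C := (norm_nonneg _).trans (hC a (left_mem_Icc.2 hab))
  -- `R` is the Grönwall bound for the solution. Truncating the argument at `R` bounds the field by
  -- `C * R` everywhere, so Picard–Lindelöf covers all of `[a, b]` at once.
  set R := ‖x₀‖ * Real.exp (C * (b - a)) with hR
  have hR0 : 0 ≤ R := by positivity
  have hpl : IsPicardLindelof (fun s x => F s (clampPi R x)) (⟨a, left_mem_Icc.2 hab⟩ : Icc a b)
      x₀ (⟨C * R, by positivity⟩ * ⟨b - a, sub_nonneg.2 hab⟩) 0 ⟨C * R, by positivity⟩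
      ⟨C, hC0⟩ := by
    refine ⟨fun s hs => ?_, fun x _ => ?_, fun s hs x _ => ?_, ?_⟩
    · refine (LipschitzWith.of_dist_le_mul fun x y => ?_).lipschitzOnWith
      rw [dist_eq_norm, ← map_sub]
      refine ((F s).le_of_opNorm_le (hC s hs) _).trans ?_
      rw [← dist_eq_norm]
      have := (lipschitzWith_clampPi R).dist_le_mul x y
      rw [NNReal.coe_one, one_mul] at this
      exact mul_le_mul_of_nonneg_left this hC0
    · exact hF.clm_apply continuousOn_const
    · exact ((F s).le_of_opNorm_le (hC s hs) _).trans
        (mul_le_mul_of_nonneg_left (norm_clampPi_le hR0 x) hC0)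
    · rw [max_eq_left (by simpa using hab)]
      exact (sub_zero _).ge
  obtain ⟨x, hx0, hx⟩ := hpl.exists_eq_forall_mem_Icc_hasDerivWithinAt₀
  refine ⟨x, hx0, fun s hs => ?_⟩
  -- Truncation does not increase the norm, so Grönwall with the same `C` applies to the truncated
  -- equation; the solution stays where the truncation is the identity.
  have hbound : ‖x s‖ ≤ R := by
    have := norm_le_gronwallBound_of_norm_deriv_right_le (f := x) (δ := ‖x₀‖) (K := C) (ε := 0)
      (fun r hr => (hx r hr).continuousWithinAt)
      (fun r hr => ((hx r (Ico_subset_Icc_self hr)).mono_of_mem_nhdsWithin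
        (Icc_mem_nhdsGE_of_mem hr)))
      (by rw [hx0]) (fun r hr => ?_) s hs
    · rw [gronwallBound_ε0] at this
      refine this.trans ?_
      rw [hR]
      gcongr
      exact hs.2
    · rw [add_zero]
      exact ((F r).le_of_opNorm_le (hC r (Ico_subset_Icc_self hr)) _).trans
        (mul_le_mul_of_nonneg_left (norm_clampPi_le_norm hR0 _) hC0)
  simpa [clampPi_eq_self hbound] using hx s hs

end LinearODE

/-! ### Continuity of matrix square root and inverse. -/

section MatrixContinuity

open scoped MatrixOrder Matrix.Norms.L2Operator in
theorem continuousOn_matSqrt {n : ℕ} :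
    ContinuousOn (matSqrt : Matrix (Fin n) (Fin n) ℝ → _) {M | M.PosSemidef} := by
  have h := CFC.continuousOn_sqrt (A := Matrix (Fin n) (Fin n) ℝ)
  have e : {M : Matrix (Fin n) (Fin n) ℝ | 0 ≤ M} = {M | M.PosSemidef} :=
    Set.ext fun M => Matrix.nonneg_iff_posSemidef
  rw [e] at h
  exact h

theorem continuousOn_matrix_inv {n : ℕ} :
    ContinuousOn (fun M : Matrix (Fin n) (Fin n) ℝ => M⁻¹) {M | IsUnit M.det} := by
  intro M hM
  refine ContinuousAt.continuousWithinAt ?_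
  simp only [Matrix.inv_def, Ring.inverse_eq_inv']
  exact ((continuous_id.matrix_det.continuousAt).inv₀ hM.ne_zero).smul
    continuous_id.matrix_adjugate.continuousAt

end MatrixContinuity

/-! ### Euclidean norm and dot product. -/

section EuclideanNorm

theorem norm2_nonneg {n : ℕ} (v : Fin n → ℝ) : 0 ≤ norm2 v := norm_nonneg _

theorem norm2_mul_self {n : ℕ} (v : Fin n → ℝ) : norm2 v * norm2 v = v ⬝ᵥ v := by
  rw [norm2, ← real_inner_self_eq_norm_mul_norm]
  rw [EuclideanSpace.inner_eq_star_dotProduct]; simp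

theorem abs_dotProduct_le_norm2 {n : ℕ} (v w : Fin n → ℝ) : |v ⬝ᵥ w| ≤ norm2 v * norm2 w := by
  have h := abs_real_inner_le_norm (WithLp.toLp 2 v) (WithLp.toLp 2 w)
  rw [EuclideanSpace.inner_eq_star_dotProduct] at h
  simpa [norm2, dotProduct_comm] using h

theorem dotProduct_self_nonneg_real {n : ℕ} (v : Fin n → ℝ) : 0 ≤ v ⬝ᵥ v := by
  rw [← norm2_mul_self]; exact mul_self_nonneg _

theorem dotProduct_self_le_one_iff {n : ℕ} (v : Fin n → ℝ) : v ⬝ᵥ v ≤ 1 ↔ norm2 v ≤ 1 := by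
  rw [← norm2_mul_self, ← sq, sq_le_one_iff₀ (norm2_nonneg v)]

end EuclideanNorm

/-! ### Symmetric matrices and their square roots. -/

section SymmetricMatrices

variable {n : ℕ}

theorem Matrix.dotProduct_mulVec_transpose {k l : ℕ} (M : Matrix (Fin k) (Fin l) ℝ)
    (v : Fin k → ℝ) (w : Fin l → ℝ) : v ⬝ᵥ (M *ᵥ w) = (Mᵀ *ᵥ v) ⬝ᵥ w := by
  rw [Matrix.dotProduct_mulVec, Matrix.mulVec_transpose]

theorem matSqrt_transpose (Q : Matrix (Fin n) (Fin n) ℝ) : (matSqrt Q)ᵀ = matSqrt Q := by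
  have := (matSqrt_posSemidef Q).isHermitian
  rwa [Matrix.IsHermitian, Matrix.conjTranspose_eq_transpose_of_trivial] at this

theorem isUnit_det_matSqrt {Q : Matrix (Fin n) (Fin n) ℝ} (hQ : Q.PosDef) :
    IsUnit (matSqrt Q).det := by
  have h : (matSqrt Q).det * (matSqrt Q).det = Q.det := by
    rw [← Matrix.det_mul, matSqrt_mul_self hQ.posSemidef]
  refine isUnit_iff_ne_zero.2 fun h0 => hQ.det_pos.ne' ?_
  rw [← h, h0, mul_zero]

theorem inv_matSqrt_transpose (Q : Matrix (Fin n) (Fin n) ℝ) :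
    ((matSqrt Q)⁻¹)ᵀ = (matSqrt Q)⁻¹ := by
  rw [Matrix.transpose_nonsing_inv, matSqrt_transpose]

theorem inv_matSqrt_mul_self {Q : Matrix (Fin n) (Fin n) ℝ} (hQ : Q.PosDef) :
    (matSqrt Q)⁻¹ * (matSqrt Q)⁻¹ = Q⁻¹ := by
  rw [← Matrix.mul_inv_rev, matSqrt_mul_self hQ.posSemidef]

theorem dotProduct_inv_mulVec_eq {Q : Matrix (Fin n) (Fin n) ℝ} (hQ : Q.PosDef)
    (z : Fin n → ℝ) :
    z ⬝ᵥ (Q⁻¹ *ᵥ z) = ((matSqrt Q)⁻¹ *ᵥ z) ⬝ᵥ ((matSqrt Q)⁻¹ *ᵥ z) := by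
  rw [← inv_matSqrt_mul_self hQ, ← Matrix.mulVec_mulVec, Matrix.dotProduct_mulVec_transpose,
    inv_matSqrt_transpose]

/-- A symmetric matrix `H` has the same range as `H²`; the preimage under `H²` can be chosen so
that its image under `H` is no longer than the given vector. -/
theorem exists_mul_self_mulVec_eq {H : Matrix (Fin n) (Fin n) ℝ} (hH : Hᵀ = H)
    (r : Fin n → ℝ) :
    ∃ h, (H * H) *ᵥ h = H *ᵥ r ∧ (H *ᵥ h) ⬝ᵥ (H *ᵥ h) ≤ r ⬝ᵥ r := by
  have hle : LinearMap.range (H * H).mulVecLin ≤ LinearMap.range H.mulVecLin := by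
    rw [Matrix.mulVecLin_mul]
    exact LinearMap.range_comp_le_range _ _
  have hrank : (H * H).rank = H.rank := by
    simpa [hH] using Matrix.rank_transpose_mul_self H
  have heq := Submodule.eq_of_le_of_finrank_eq hle hrank
  have hr : H *ᵥ r ∈ LinearMap.range (H * H).mulVecLin := by
    rw [heq]; exact ⟨r, rfl⟩
  obtain ⟨h, hh⟩ := hr
  refine ⟨h, hh, ?_⟩
  have h1 : (H *ᵥ h) ⬝ᵥ (H *ᵥ h) = r ⬝ᵥ (H *ᵥ h) := by
    rw [Matrix.dotProduct_mulVec_transpose, Matrix.dotProduct_mulVec_transpose, hH,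
      Matrix.mulVec_mulVec]
    exact congrArg (· ⬝ᵥ h) hh
  -- Since `‖Hh‖² = ⟨r, Hh⟩`, the square `‖r - Hh‖²` equals `‖r‖² - ‖Hh‖²`.
  have h2 := dotProduct_self_nonneg_real (r - H *ᵥ h)
  simp only [sub_dotProduct, dotProduct_sub] at h2
  rw [dotProduct_comm (H *ᵥ h) r] at h2
  linarith

end SymmetricMatrices

/-! ### Minimal norm solutions and their measurable dependence on time. -/

section MinimalNorm

variable {n m : ℕ}

/-- Tikhonov regularisation: `Cᵀ (C Cᵀ + ε)⁻¹ C Cᵀ h → Cᵀ h` as `ε → 0`. -/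
theorem tendsto_tikhonov (C : Matrix (Fin n) (Fin m) ℝ) (h : Fin n → ℝ) :
    Filter.Tendsto
      (fun k : ℕ => Cᵀ *ᵥ ((C * Cᵀ + ((k : ℝ) + 1)⁻¹ • 1)⁻¹ *ᵥ ((C * Cᵀ) *ᵥ h)))
      Filter.atTop (nhds (Cᵀ *ᵥ h)) := by
  have key : ∀ (k : ℕ) (i : Fin m),
      |(Cᵀ *ᵥ ((C * Cᵀ + ((k : ℝ) + 1)⁻¹ • 1)⁻¹ *ᵥ ((C * Cᵀ) *ᵥ h)) - Cᵀ *ᵥ h) i| ≤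
        √(((k : ℝ) + 1)⁻¹ * (h ⬝ᵥ h)) := by
    intro k i
    set ε : ℝ := ((k : ℝ) + 1)⁻¹ with hε
    have hε0 : 0 < ε := by positivity
    have hpd : (C * Cᵀ + ε • (1 : Matrix (Fin n) (Fin n) ℝ)).PosDef := by
      have h1 : (C * Cᵀ).PosSemidef := by
        simpa using Matrix.posSemidef_self_mul_conjTranspose C
      exact Matrix.PosDef.posSemidef_add h1 (Matrix.PosDef.one.smul hε0)
    have hu : IsUnit (C * Cᵀ + ε • (1 : Matrix (Fin n) (Fin n) ℝ)).det :=
      isUnit_iff_ne_zero.2 hpd.det_pos.ne'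
    set N := C * Cᵀ + ε • (1 : Matrix (Fin n) (Fin n) ℝ) with hN
    set r := N⁻¹ *ᵥ h with hr
    have hNr : (C * Cᵀ) *ᵥ r + ε • r = h := by
      have : N *ᵥ r = h := by
        rw [hr, Matrix.mulVec_mulVec, Matrix.mul_nonsing_inv _ hu, Matrix.one_mulVec]
      rw [← this, hN, Matrix.add_mulVec, Matrix.smul_mulVec, Matrix.one_mulVec]
    have hMh : N⁻¹ *ᵥ ((C * Cᵀ) *ᵥ h) = h - ε • r := by
      have : (C * Cᵀ) *ᵥ h = N *ᵥ h - ε • h := by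
        rw [hN, Matrix.add_mulVec, Matrix.smul_mulVec, Matrix.one_mulVec, add_sub_cancel_right]
      rw [this, Matrix.mulVec_sub, Matrix.mulVec_mulVec, Matrix.nonsing_inv_mul _ hu,
        Matrix.one_mulVec, Matrix.mulVec_smul]
    -- The error is explicit. Pairing `N r = h` with `r` controls `‖Cᵀ r‖²`, which gives an error of
    -- order `√ε`.
    have hdiff : Cᵀ *ᵥ (N⁻¹ *ᵥ ((C * Cᵀ) *ᵥ h)) - Cᵀ *ᵥ h = -(ε • (Cᵀ *ᵥ r)) := by
      rw [hMh, Matrix.mulVec_sub, Matrix.mulVec_smul]; abel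
    rw [hdiff]
    refine Real.abs_le_sqrt ?_
    have henergy : (Cᵀ *ᵥ r) ⬝ᵥ (Cᵀ *ᵥ r) + ε * (r ⬝ᵥ r) = r ⬝ᵥ h := by
      conv_rhs => rw [← hNr]
      rw [dotProduct_add, dotProduct_smul, ← Matrix.mulVec_mulVec,
        Matrix.dotProduct_mulVec_transpose C, smul_eq_mul]
    have hi : (Cᵀ *ᵥ r) i ^ 2 ≤ (Cᵀ *ᵥ r) ⬝ᵥ (Cᵀ *ᵥ r) := by
      rw [sq]
      exact Finset.single_le_sum (f := fun j => (Cᵀ *ᵥ r) j * (Cᵀ *ᵥ r) j)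
        (fun j _ => mul_self_nonneg _) (Finset.mem_univ i)
    -- Young's inequality: `ε⟨r, h⟩ ≤ ‖h‖² + ε²‖r‖²/4`, whose last term is absorbed by `-ε²‖r‖²`.
    have hsq := dotProduct_self_nonneg_real (h - (ε / 2) • r)
    simp only [sub_dotProduct, dotProduct_sub, smul_dotProduct, dotProduct_smul, smul_eq_mul]
      at hsq
    rw [dotProduct_comm h r] at hsq
    have hrr := dotProduct_self_nonneg_real r
    have h1 : (-(ε • (Cᵀ *ᵥ r))) i ^ 2 = ε ^ 2 * (Cᵀ *ᵥ r) i ^ 2 := by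
      simp only [Pi.neg_apply, Pi.smul_apply, smul_eq_mul]; ring
    rw [h1]
    calc ε ^ 2 * (Cᵀ *ᵥ r) i ^ 2 ≤ ε ^ 2 * (r ⬝ᵥ h - ε * (r ⬝ᵥ r)) := by
          gcongr; linarith
      _ = ε * (ε * (r ⬝ᵥ h) - ε ^ 2 * (r ⬝ᵥ r)) := by ring
      _ ≤ ε * (h ⬝ᵥ h) := by
          gcongr
          nlinarith [mul_nonneg (sq_nonneg ε) hrr]
  rw [tendsto_pi_nhds]
  intro i
  rw [tendsto_iff_norm_sub_tendsto_zero]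
  refine squeeze_zero (fun _ => norm_nonneg _) (fun k => key k i) ?_
  have h0 : Filter.Tendsto (fun k : ℕ => ((k : ℝ) + 1)⁻¹) Filter.atTop (nhds 0) := by
    simpa using tendsto_one_div_add_atTop_nhds_zero_nat (𝕜 := ℝ)
  simpa using ((h0.mul_const (h ⬝ᵥ h)).sqrt)

/-- The minimal norm solution `w` of `C w = (C Cᵀ)^{1/2} r` satisfies `‖w‖ ≤ ‖r‖` and is the
limit of the regularised solutions. -/
theorem exists_tendsto_minimal_solution (C : Matrix (Fin n) (Fin m) ℝ) (r : Fin n → ℝ) :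
    ∃ w : Fin m → ℝ, C *ᵥ w = matSqrt (C * Cᵀ) *ᵥ r ∧ w ⬝ᵥ w ≤ r ⬝ᵥ r ∧
      Filter.Tendsto (fun k : ℕ => Cᵀ *ᵥ ((C * Cᵀ + ((k : ℝ) + 1)⁻¹ • 1)⁻¹ *ᵥ
        (matSqrt (C * Cᵀ) *ᵥ r))) Filter.atTop (nhds w) := by
  have hpsd : (C * Cᵀ).PosSemidef := by
    simpa using Matrix.posSemidef_self_mul_conjTranspose C
  obtain ⟨h, h1, h2⟩ := exists_mul_self_mulVec_eq (matSqrt_transpose (C * Cᵀ)) r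
  rw [matSqrt_mul_self hpsd] at h1
  -- For `H = (C Cᵀ)^{1/2}`, both `‖Cᵀ h‖²` and `‖H h‖²` equal `⟨h, C Cᵀ h⟩`.
  refine ⟨Cᵀ *ᵥ h, by rw [Matrix.mulVec_mulVec, h1], ?_, ?_⟩
  · refine le_of_eq_of_le ?_ h2
    rw [Matrix.dotProduct_mulVec_transpose (matSqrt (C * Cᵀ)), matSqrt_transpose,
      Matrix.mulVec_mulVec, matSqrt_mul_self hpsd, ← Matrix.mulVec_mulVec,
      Matrix.dotProduct_mulVec_transpose Cᵀ, Matrix.transpose_transpose]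
  · rw [← h1]
    exact tendsto_tikhonov C h

/-- Measurable selection of minimal norm solutions. -/
theorem exists_measurable_minimal_solution {K : Set ℝ}
    {C : ℝ → Matrix (Fin n) (Fin m) ℝ} (hC : ContinuousOn C K) {r : ℝ → Fin n → ℝ}
    (hr : ContinuousOn r K) :
    ∃ w : ℝ → Fin m → ℝ, Measurable (K.domRestrict w) ∧ ∀ s ∈ K,
      C s *ᵥ w s = matSqrt (C s * (C s)ᵀ) *ᵥ r s ∧ w s ⬝ᵥ w s ≤ r s ⬝ᵥ r s := by
  choose w hw1 hw2 hw3 using fun s => exists_tendsto_minimal_solution (C s) (r s)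
  refine ⟨w, ?_, fun s _ => ⟨hw1 s, hw2 s⟩⟩
  have hCr : Continuous (K.domRestrict C) := hC.domRestrict
  have hrr : Continuous (K.domRestrict r) := hr.domRestrict
  -- The minimal norm solution may jump where the rank of `C s` changes, but each regularised
  -- solution is continuous in `s`, and pointwise limits of these are measurable.
  refine measurable_of_tendsto_metrizable (f := fun (k : ℕ) (s : K) =>
    (C s)ᵀ *ᵥ ((C s * (C s)ᵀ + ((k : ℝ) + 1)⁻¹ • 1)⁻¹ *ᵥ (matSqrt (C s * (C s)ᵀ) *ᵥ r s)))
    (fun k => ?_) (tendsto_pi_nhds.2 fun s => hw3 s)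
  have hpsd : ∀ s : K, (C s * (C s)ᵀ).PosSemidef := fun s => by
    simpa using Matrix.posSemidef_self_mul_conjTranspose (C s)
  have hM : Continuous fun s : K => C s * (C s)ᵀ := hCr.matrix_mul hCr.matrix_transpose
  have hsqrt : Continuous fun s : K => matSqrt (C s * (C s)ᵀ) :=
    continuousOn_matSqrt.comp_continuous hM hpsd
  have hinv : Continuous fun s : K => (C s * (C s)ᵀ + ((k : ℝ) + 1)⁻¹ • 1)⁻¹ := by
    refine continuousOn_matrix_inv.comp_continuous (hM.add continuous_const) fun s => ?_
    exact isUnit_iff_ne_zero.2 (Matrix.PosDef.posSemidef_add (hpsd s)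
      (Matrix.PosDef.one.smul (by positivity))).det_pos.ne'
  exact (hCr.matrix_transpose.matrix_mulVec
    (hinv.matrix_mulVec (hsqrt.matrix_mulVec hrr))).measurable

end MinimalNorm

/-! ### Regularity and derivative of the form `⟨z, Q⁻¹ z⟩`. -/

section QuadraticForm

variable {n : ℕ}

open scoped Matrix.Norms.L2Operator in
/-- The entry `M i j` as a continuous linear functional of `M`. -/
noncomputable def matrixEntryCLM (i j : Fin n) : Matrix (Fin n) (Fin n) ℝ →L[ℝ] ℝ :=
  LinearMap.toContinuousLinearMap (Matrix.entryLinearMap ℝ ℝ i j)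

open scoped Matrix.Norms.L2Operator in
theorem AbsolutelyContinuousOnInterval.matrix_inv {Q : ℝ → Matrix (Fin n) (Fin n) ℝ} {a b : ℝ}
    (hQ : AbsolutelyContinuousOnInterval Q a b) (hpd : ∀ s ∈ uIcc a b, (Q s).PosDef) :
    AbsolutelyContinuousOnInterval (fun s => (Q s)⁻¹) a b := by
  have hu : ∀ s ∈ uIcc a b, IsUnit (Q s).det := fun s hs =>
    isUnit_iff_ne_zero.2 (hpd s hs).det_pos.ne'
  have hc : ContinuousOn (fun s => (Q s)⁻¹) (uIcc a b) :=
    continuousOn_matrix_inv.comp hQ.continuousOn hu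
  obtain ⟨C, hC⟩ := isCompact_uIcc.exists_bound_of_continuousOn hc
  have hC0 : 0 ≤ C := (norm_nonneg _).trans (hC a left_mem_uIcc)
  refine hQ.of_dist_le (C := C * C) fun x hx y hy => ?_
  -- With inverses bounded by `C` on the compact interval, this identity bounds increments of `Q⁻¹`
  -- by `C²` times those of `Q`.
  have h : (Q x)⁻¹ - (Q y)⁻¹ = (Q x)⁻¹ * (Q y - Q x) * (Q y)⁻¹ := by
    rw [Matrix.mul_sub, Matrix.sub_mul, Matrix.nonsing_inv_mul _ (hu x hx), Matrix.mul_assoc,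
      Matrix.mul_nonsing_inv _ (hu y hy), Matrix.one_mul, Matrix.mul_one]
  rw [dist_eq_norm, h, dist_eq_norm, norm_sub_rev (Q x)]
  calc ‖(Q x)⁻¹ * (Q y - Q x) * (Q y)⁻¹‖ ≤ ‖(Q x)⁻¹‖ * ‖Q y - Q x‖ * ‖(Q y)⁻¹‖ :=
        (norm_mul_le _ _).trans (by gcongr; exact norm_mul_le _ _)
    _ ≤ C * ‖Q y - Q x‖ * C := by
        gcongr
        exacts [hC x hx, hC y hy]
    _ = C * C * ‖Q y - Q x‖ := by ring

theorem dotProduct_mulVec_eq_sum (z : Fin n → ℝ) (M : Matrix (Fin n) (Fin n) ℝ) :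
    z ⬝ᵥ (M *ᵥ z) = ∑ i, ∑ j, z i * M i j * z j := by
  simp [dotProduct, Matrix.mulVec, Finset.mul_sum, mul_assoc]

open scoped Matrix.Norms.L2Operator in
theorem AbsolutelyContinuousOnInterval.dotProduct_inv_mulVec {z : ℝ → Fin n → ℝ}
    {Q : ℝ → Matrix (Fin n) (Fin n) ℝ} {a b : ℝ} (hz : AbsolutelyContinuousOnInterval z a b)
    (hQ : AbsolutelyContinuousOnInterval Q a b) (hpd : ∀ s ∈ uIcc a b, (Q s).PosDef) :
    AbsolutelyContinuousOnInterval (fun s => z s ⬝ᵥ ((Q s)⁻¹ *ᵥ z s)) a b := by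
  simp only [dotProduct_mulVec_eq_sum]
  have hzi : ∀ i, AbsolutelyContinuousOnInterval (fun s => z s i) a b := fun i =>
    hz.clm_comp (ContinuousLinearMap.proj (R := ℝ) (φ := fun _ : Fin n => ℝ) i)
  have hMij : ∀ i j, AbsolutelyContinuousOnInterval (fun s => (Q s)⁻¹ i j) a b := fun i j =>
    (hQ.matrix_inv hpd).clm_comp (matrixEntryCLM i j)
  exact sum _ fun i _ => sum _ fun j _ => ((hzi i).mul (hMij i j)).mul (hzi j)

open scoped Matrix.Norms.L2Operator in
theorem HasDerivAt.matrix_inv {Q : ℝ → Matrix (Fin n) (Fin n) ℝ}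
    {Q' : Matrix (Fin n) (Fin n) ℝ} {s : ℝ} (hQ : HasDerivAt Q Q' s) (hpd : (Q s).PosDef) :
    HasDerivAt (fun s => (Q s)⁻¹) (-((Q s)⁻¹ * Q' * (Q s)⁻¹)) s := by
  obtain ⟨U, hU⟩ := hpd.isUnit
  have h := hasFDerivAt_ringInverse (𝕜 := ℝ) U
  rw [hU] at h
  have h2 := h.comp_hasDerivAt s hQ
  have hUi : ((U⁻¹ : (Matrix (Fin n) (Fin n) ℝ)ˣ) : Matrix (Fin n) (Fin n) ℝ) = (Q s)⁻¹ := by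
    rw [← hU, Matrix.coe_units_inv]
  simpa [Function.comp_def, ← Matrix.nonsing_inv_eq_ringInverse, hUi] using h2

open scoped Matrix.Norms.L2Operator in
theorem HasDerivAt.dotProduct_inv_mulVec {z : ℝ → Fin n → ℝ} {Q : ℝ → Matrix (Fin n) (Fin n) ℝ}
    {z' : Fin n → ℝ} {Q' : Matrix (Fin n) (Fin n) ℝ} {s : ℝ} (hz : HasDerivAt z z' s)
    (hQ : HasDerivAt Q Q' s) (hpd : (Q s).PosDef) :
    HasDerivAt (fun s => z s ⬝ᵥ ((Q s)⁻¹ *ᵥ z s))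
      (2 * (((Q s)⁻¹ *ᵥ z s) ⬝ᵥ z') - ((Q s)⁻¹ *ᵥ z s) ⬝ᵥ (Q' *ᵥ ((Q s)⁻¹ *ᵥ z s))) s := by
  have hzi := hasDerivAt_pi.1 hz
  have hMij : ∀ i j, HasDerivAt (fun s => (Q s)⁻¹ i j) ((-((Q s)⁻¹ * Q' * (Q s)⁻¹)) i j) s :=
    fun i j => (matrixEntryCLM i j).hasFDerivAt.comp_hasDerivAt s (hQ.matrix_inv hpd)
  have hsym : ((Q s)⁻¹)ᵀ = (Q s)⁻¹ := by
    have := hpd.inv.isHermitian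
    rwa [Matrix.IsHermitian, Matrix.conjTranspose_eq_transpose_of_trivial] at this
  simp only [dotProduct_mulVec_eq_sum (n := n) (z _)]
  have h := HasDerivAt.fun_sum (u := Finset.univ) fun i _ =>
    HasDerivAt.fun_sum (u := Finset.univ) fun j _ => ((hzi i).mul (hMij i j)).mul (hzi j)
  refine h.congr_deriv ?_
  set M := (Q s)⁻¹
  set D := -(M * Q' * M) with hD
  have e1 : ∑ i, ∑ j, ((z' i * M i j + z s i * D i j) * z s j + z s i * M i j * z' j) =
      z' ⬝ᵥ (M *ᵥ z s) + z s ⬝ᵥ (D *ᵥ z s) + z s ⬝ᵥ (M *ᵥ z') := by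
    simp only [dotProduct, Matrix.mulVec, Finset.mul_sum, ← Finset.sum_add_distrib]
    exact Finset.sum_congr rfl fun i _ => Finset.sum_congr rfl fun j _ => by ring
  refine Eq.trans e1 ?_
  have e2 : z s ⬝ᵥ (D *ᵥ z s) = -((M *ᵥ z s) ⬝ᵥ (Q' *ᵥ (M *ᵥ z s))) := by
    rw [hD, Matrix.neg_mulVec, dotProduct_neg, ← Matrix.mulVec_mulVec, ← Matrix.mulVec_mulVec,
      Matrix.dotProduct_mulVec_transpose M, hsym]
  rw [e2, Matrix.dotProduct_mulVec_transpose M (z s) z', hsym, dotProduct_comm z']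
  ring

end QuadraticForm

/-! ### Pointwise algebra of the ellipsoid equations. -/

section Flow

variable {n m : ℕ}

theorem matSqrt_mulVec_inv_mulVec {Q : Matrix (Fin n) (Fin n) ℝ} (hQ : Q.PosDef)
    (z : Fin n → ℝ) : matSqrt Q *ᵥ (Q⁻¹ *ᵥ z) = (matSqrt Q)⁻¹ *ᵥ z := by
  rw [← inv_matSqrt_mul_self hQ, Matrix.mulVec_mulVec, ← Matrix.mul_assoc,
    Matrix.mul_nonsing_inv _ (isUnit_det_matSqrt hQ), Matrix.one_mul]

/-- Each outer factor `Q^{1/2}` turns `Q⁻¹ z` into `Q^{-1/2} z`; the two inner summands are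
transposes of each other and have the same quadratic form. -/
theorem dotProduct_rUnder_mulVec (B : Matrix (Fin n) (Fin m) ℝ) (P : Matrix (Fin m) (Fin m) ℝ)
    (S : Matrix (Fin n) (Fin n) ℝ) {Q : Matrix (Fin n) (Fin n) ℝ} (hQ : Q.PosDef)
    (z : Fin n → ℝ) :
    (Q⁻¹ *ᵥ z) ⬝ᵥ (rUnder B P S Q *ᵥ (Q⁻¹ *ᵥ z)) =
      2 * ((matSqrt (qStar B P Q) *ᵥ ((matSqrt Q)⁻¹ *ᵥ z)) ⬝ᵥ (S *ᵥ ((matSqrt Q)⁻¹ *ᵥ z))) := by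
  set w := (matSqrt Q)⁻¹ *ᵥ z with hw
  set H := matSqrt (qStar B P Q) with hH
  rw [rUnder, ← Matrix.mulVec_mulVec, ← Matrix.mulVec_mulVec, matSqrt_mulVec_inv_mulVec hQ,
    Matrix.dotProduct_mulVec_transpose, matSqrt_transpose, matSqrt_mulVec_inv_mulVec hQ, ← hw,
    ← hH, Matrix.add_mulVec, dotProduct_add, ← Matrix.mulVec_mulVec, ← Matrix.mulVec_mulVec,
    Matrix.dotProduct_mulVec_transpose H, Matrix.dotProduct_mulVec_transpose Sᵀ,
    Matrix.transpose_transpose, hH, matSqrt_transpose, dotProduct_comm (S *ᵥ w)]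
  ring

/-- Derivative of `⟨z, Q⁻¹ z⟩` along `z' = A z + d` and the shape equation. -/
theorem quadraticForm_deriv_eq (A : Matrix (Fin n) (Fin n) ℝ) (B : Matrix (Fin n) (Fin m) ℝ)
    (P : Matrix (Fin m) (Fin m) ℝ) (S : Matrix (Fin n) (Fin n) ℝ)
    {Q : Matrix (Fin n) (Fin n) ℝ} (hQ : Q.PosDef) (z d : Fin n → ℝ) :
    2 * ((Q⁻¹ *ᵥ z) ⬝ᵥ (A *ᵥ z + d)) -
        (Q⁻¹ *ᵥ z) ⬝ᵥ ((A * Q + Q * Aᵀ - rUnder B P S Q) *ᵥ (Q⁻¹ *ᵥ z)) =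
      2 * ((Q⁻¹ *ᵥ z) ⬝ᵥ d) +
        2 * ((matSqrt (qStar B P Q) *ᵥ ((matSqrt Q)⁻¹ *ᵥ z)) ⬝ᵥ
          (S *ᵥ ((matSqrt Q)⁻¹ *ᵥ z))) := by
  have hz : Q *ᵥ (Q⁻¹ *ᵥ z) = z := by
    rw [Matrix.mulVec_mulVec, Matrix.mul_nonsing_inv _ (isUnit_iff_ne_zero.2 hQ.det_pos.ne'),
      Matrix.one_mulVec]
  have hsym : Qᵀ = Q := by
    have := hQ.isHermitian
    rwa [Matrix.IsHermitian, Matrix.conjTranspose_eq_transpose_of_trivial] at this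
  have hR := dotProduct_rUnder_mulVec B P S hQ z
  set y := Q⁻¹ *ᵥ z
  -- The summands `A Q` and `Q Aᵀ` contribute equally, so together they cancel `2⟨y, A z⟩`.
  have h1 : y ⬝ᵥ ((Q * Aᵀ) *ᵥ y) = y ⬝ᵥ (A *ᵥ z) := by
    rw [← Matrix.mulVec_mulVec, Matrix.dotProduct_mulVec_transpose, hsym, hz,
      Matrix.dotProduct_mulVec_transpose, Matrix.transpose_transpose, dotProduct_comm]
  rw [Matrix.sub_mulVec, Matrix.add_mulVec, dotProduct_sub, dotProduct_add, dotProduct_add, h1,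
    hR, ← Matrix.mulVec_mulVec, hz]
  ring

/-- The factor `Q^{-1/2} B P^{1/2}` is the input matrix in coordinates where both ellipsoids are
unit balls; this form lets the minimal norm results apply. -/
theorem qStar_eq_mul_transpose (B : Matrix (Fin n) (Fin m) ℝ) {P : Matrix (Fin m) (Fin m) ℝ}
    (hP : P.PosSemidef) (Q : Matrix (Fin n) (Fin n) ℝ) :
    qStar B P Q = ((matSqrt Q)⁻¹ * B * matSqrt P) * ((matSqrt Q)⁻¹ * B * matSqrt P)ᵀ := by
  rw [qStar, Matrix.transpose_mul, Matrix.transpose_mul, inv_matSqrt_transpose,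
    matSqrt_transpose]
  conv_lhs => rw [← matSqrt_mul_self hP]
  simp only [Matrix.mul_assoc]

theorem qStar_posSemidef (B : Matrix (Fin n) (Fin m) ℝ) {P : Matrix (Fin m) (Fin m) ℝ}
    (hP : P.PosSemidef) (Q : Matrix (Fin n) (Fin n) ℝ) : (qStar B P Q).PosSemidef := by
  rw [qStar_eq_mul_transpose B hP]
  simpa using Matrix.posSemidef_self_mul_conjTranspose ((matSqrt Q)⁻¹ * B * matSqrt P)

/-- The support function estimate `|⟨Q⁻¹ z, B v⟩| ≤ ‖𝒬⋆^{1/2} Q^{-1/2} z‖` for `v ∈ ℰ(0, P)`. -/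
theorem abs_dotProduct_input_le (B : Matrix (Fin n) (Fin m) ℝ) {P : Matrix (Fin m) (Fin m) ℝ}
    (hP : P.PosDef) {Q : Matrix (Fin n) (Fin n) ℝ} (hQ : Q.PosDef) (z : Fin n → ℝ)
    {v : Fin m → ℝ} (hv : v ⬝ᵥ (P⁻¹ *ᵥ v) ≤ 1) :
    |(Q⁻¹ *ᵥ z) ⬝ᵥ (B *ᵥ v)| ≤ norm2 (matSqrt (qStar B P Q) *ᵥ ((matSqrt Q)⁻¹ *ᵥ z)) := by
  set w := (matSqrt Q)⁻¹ *ᵥ z with hw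
  set C := (matSqrt Q)⁻¹ * B * matSqrt P with hC
  have h1 : (Q⁻¹ *ᵥ z) ⬝ᵥ (B *ᵥ v) = (Cᵀ *ᵥ w) ⬝ᵥ ((matSqrt P)⁻¹ *ᵥ v) := by
    rw [← Matrix.dotProduct_mulVec_transpose, Matrix.mulVec_mulVec, hC, Matrix.mul_assoc,
      Matrix.mul_nonsing_inv _ (isUnit_det_matSqrt hP), Matrix.mul_one, ← Matrix.mulVec_mulVec,
      Matrix.dotProduct_mulVec_transpose (matSqrt Q)⁻¹, inv_matSqrt_transpose, hw,
      Matrix.mulVec_mulVec, inv_matSqrt_mul_self hQ]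
  clear_value w
  -- Both squared norms are `⟨w, C Cᵀ w⟩`.
  have h2 : norm2 (Cᵀ *ᵥ w) = norm2 (matSqrt (qStar B P Q) *ᵥ w) := by
    rw [← mul_self_inj (norm2_nonneg _) (norm2_nonneg _), norm2_mul_self, norm2_mul_self,
      Matrix.dotProduct_mulVec_transpose Cᵀ,
      Matrix.dotProduct_mulVec_transpose (matSqrt (qStar B P Q)) (matSqrt (qStar B P Q) *ᵥ w),
      Matrix.transpose_transpose, matSqrt_transpose, Matrix.mulVec_mulVec, Matrix.mulVec_mulVec,
      matSqrt_mul_self (qStar_posSemidef B hP.posSemidef Q),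
      qStar_eq_mul_transpose B hP.posSemidef]
  have h3 : norm2 ((matSqrt P)⁻¹ *ᵥ v) ≤ 1 := by
    rw [dotProduct_inv_mulVec_eq hP, ← norm2_mul_self] at hv
    nlinarith [norm2_nonneg ((matSqrt P)⁻¹ *ᵥ v)]
  rw [h1, ← h2]
  exact (abs_dotProduct_le_norm2 _ _).trans (mul_le_of_le_one_right (norm2_nonneg _) h3)

/-- Alignment turns the cross term into a product of norms. -/
theorem dotProduct_eq_of_aligned {a w : Fin n → ℝ} {S : Matrix (Fin n) (Fin n) ℝ}
    (h : a ≠ 0 → (norm2 w)⁻¹ • (S *ᵥ w) = (norm2 a)⁻¹ • a) :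
    a ⬝ᵥ (S *ᵥ w) = norm2 w * norm2 a := by
  have hz : ∀ v : Fin n → ℝ, norm2 v = 0 ↔ v = 0 := fun v => by simp [norm2]
  by_cases ha : a = 0
  · simp [ha, norm2]
  have hna : norm2 a ≠ 0 := fun h0 => ha ((hz a).1 h0)
  by_cases hw : w = 0
  · simp [hw, norm2]
  have hnw : norm2 w ≠ 0 := fun h0 => hw ((hz w).1 h0)
  have h1 : S *ᵥ w = (norm2 w * (norm2 a)⁻¹) • a := by
    rw [mul_smul, ← h ha, smul_inv_smul₀ hnw]
  rw [h1, dotProduct_smul, ← norm2_mul_self, smul_eq_mul]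
  field_simp

end Flow

/-! ### The moving ellipsoid along trajectories: invariance and reachability. -/

section EllipsoidalTube

variable {n m : ℕ} {T : ℝ} {A : ℝ → Matrix (Fin n) (Fin n) ℝ} {B : ℝ → Matrix (Fin n) (Fin m) ℝ}
  {p : Fin m → ℝ} {P : Matrix (Fin m) (Fin m) ℝ} {xe : Fin n → ℝ}
  {Xe : Matrix (Fin n) (Fin n) ℝ} {S : ℝ → Matrix (Fin n) (Fin n) ℝ} {q : ℝ → Fin n → ℝ}
  {Q : ℝ → Matrix (Fin n) (Fin n) ℝ}

theorem uIcc_subset_uIcc_of_mem {t T : ℝ} (ht : t ∈ Icc 0 T) : uIcc t T ⊆ uIcc 0 T := by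
  rw [uIcc_of_le ht.2, uIcc_of_le (ht.1.trans ht.2)]
  exact Icc_subset_Icc_left ht.1

open scoped Matrix.Norms.L2Operator in
theorem IsEllipsoidFlow.continuousOn_shape (h : IsEllipsoidFlow T A B p P xe Xe S q Q)
    (hT : 0 ≤ T) : ContinuousOn Q (Icc 0 T) := by
  have := h.shape_ode.1.continuousOn
  rwa [uIcc_of_le hT] at this

open scoped Matrix.Norms.L2Operator in
theorem IsEllipsoidFlow.absolutelyContinuous_quadraticForm
    (h : IsEllipsoidFlow T A B p P xe Xe S q Q) {t : ℝ} (ht : t ∈ Icc 0 T)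
    {x : ℝ → Fin n → ℝ} (hx : AbsolutelyContinuousOnInterval x t T) :
    AbsolutelyContinuousOnInterval
      (fun s => (x s - q s) ⬝ᵥ ((Q s)⁻¹ *ᵥ (x s - q s))) t T := by
  have hsub := uIcc_subset_uIcc_of_mem ht
  refine (hx.sub (h.center_ode.1.mono hsub)).dotProduct_inv_mulVec (h.shape_ode.1.mono hsub)
    fun s hs => h.shape_posDef s ?_
  rw [← uIcc_of_le (ht.1.trans ht.2)]
  exact hsub hs

/-- Along any trajectory, the derivative of the quadratic form defining the moving ellipsoid. -/
theorem IsEllipsoidFlow.ae_hasDerivAt_quadraticForm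
    (h : IsEllipsoidFlow T A B p P xe Xe S q Q) {t : ℝ} (ht : t ∈ Icc 0 T)
    {u : ℝ → Fin m → ℝ} {x : ℝ → Fin n → ℝ} (hx : IsTrajectory (ltvField A B) t T u x) :
    ∀ᵐ s ∂volume, s ∈ Ioo t T →
      HasDerivAt (fun s => (x s - q s) ⬝ᵥ ((Q s)⁻¹ *ᵥ (x s - q s)))
        (2 * (((Q s)⁻¹ *ᵥ (x s - q s)) ⬝ᵥ (B s *ᵥ (u s - p))) +
          2 * ((matSqrt (qStar (B s) P (Q s)) *ᵥ wHat (q s) (Q s) (x s)) ⬝ᵥ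
            (S s *ᵥ wHat (q s) (Q s) (x s)))) s := by
  filter_upwards [h.center_ode.2, h.shape_ode.2, hx.2] with s hq hQ hxs hs
  have hs0 : s ∈ Ioo 0 T := ⟨ht.1.trans_lt hs.1, hs.2⟩
  have hpd := h.shape_posDef s (Ioo_subset_Icc_self hs0)
  have hz : HasDerivAt (fun s => x s - q s) (A s *ᵥ (x s - q s) + B s *ᵥ (u s - p)) s := by
    refine ((hxs hs).sub (hq hs0)).congr_deriv ?_
    rw [ltvField, Matrix.mulVec_sub, Matrix.mulVec_sub]
    abel
  refine (hz.dotProduct_inv_mulVec (hQ hs0) hpd).congr_deriv ?_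
  exact quadraticForm_deriv_eq (A s) (B s) P (S s) hpd (x s - q s) (B s *ᵥ (u s - p))

theorem mem_ellipsoid_iff_norm2_wHat_le {q x : Fin n → ℝ} {Q : Matrix (Fin n) (Fin n) ℝ}
    (hQ : Q.PosDef) : x ∈ ellipsoid q Q ↔ norm2 (wHat q Q x) ≤ 1 := by
  rw [ellipsoid, mem_ofPred_eq, dotProduct_inv_mulVec_eq hQ]
  exact dotProduct_self_le_one_iff _

/-- Aligned trajectories that reach the terminal set stay in the moving ellipsoid. -/
theorem IsEllipsoidFlow.mem_ellipsoid_of_isAligned (h : IsEllipsoidFlow T A B p P xe Xe S q Q)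
    (hP : P.PosDef) {t : ℝ} (ht : t ∈ Icc 0 T) {u : ℝ → Fin m → ℝ}
    (hu : u ∈ admissibleControls (ellipsoid p P) t T) {x : ℝ → Fin n → ℝ}
    (hx : IsTrajectory (ltvField A B) t T u x) (hxT : x T ∈ ellipsoid xe Xe)
    (hal : IsAligned t T B P S q Q x) {s : ℝ} (hs : s ∈ Icc t T) :
    x s ∈ ellipsoid (q s) (Q s) := by
  have hac := h.absolutelyContinuous_quadraticForm ht hx.1
  have hsub : uIcc s T ⊆ uIcc t T := by
    rw [uIcc_of_le hs.2, uIcc_of_le ht.2]; exact Icc_subset_Icc_left hs.1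
  refine (hac.mono hsub).le_of_ae_deriv_nonneg_of_gt hs.2 ?_ ?_
  · rw [h.center_final, h.shape_final]; exact hxT
  filter_upwards [h.ae_hasDerivAt_quadraticForm ht hx] with r hr hrs hgt
  have hrt : r ∈ Ioo t T := ⟨hs.1.trans_lt hrs.1, hrs.2⟩
  have hpd := h.shape_posDef r ⟨ht.1.trans hrt.1.le, hrt.2.le⟩
  rw [(hr hrt).deriv, dotProduct_eq_of_aligned (hal r (Ioo_subset_Icc_self hrt))]
  have h1 := abs_dotProduct_input_le (B r) hP hpd (x r - q r)
    (hu.2 r (Ioo_subset_Icc_self hrt))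
  have h2 : 1 < norm2 (wHat (q r) (Q r) (x r)) := by
    by_contra! hle
    exact hgt.not_ge ((mem_ellipsoid_iff_norm2_wHat_le hpd).2 hle)
  have h3 := norm2_nonneg (matSqrt (qStar (B r) P (Q r)) *ᵥ wHat (q r) (Q r) (x r))
  rw [← wHat] at h1
  -- The derivative is at least `2‖Hŵ‖(‖ŵ‖ - 1)`, and `‖ŵ‖ > 1` here.
  nlinarith [(abs_le.1 h1).1]

/-- A continuous derivative is bounded on the compact interval, so the function is Lipschitz. -/
theorem absolutelyContinuousOnInterval_of_hasDerivWithinAt {E : Type*} [NormedAddCommGroup E]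
    [NormedSpace ℝ E] {x x' : ℝ → E} {a b : ℝ} (hab : a ≤ b)
    (hx : ∀ s ∈ Icc a b, HasDerivWithinAt x (x' s) (Icc a b) s)
    (hx' : ContinuousOn x' (Icc a b)) : AbsolutelyContinuousOnInterval x a b := by
  obtain ⟨C, hC⟩ := isCompact_Icc.exists_bound_of_continuousOn hx'
  have hC0 : 0 ≤ C := (norm_nonneg _).trans (hC a (left_mem_Icc.2 hab))
  have := Convex.lipschitzOnWith_of_nnnorm_hasDerivWithin_le (C := ⟨C, hC0⟩) (convex_Icc a b) hx
    fun s hs => hC s hs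
  rw [← uIcc_of_le hab] at this
  exact this.absolutelyContinuousOnInterval

/-- Global existence for `z' = M(s) z` with a continuous matrix function `M`. -/
theorem exists_matrix_ode_solution {M : ℝ → Matrix (Fin n) (Fin n) ℝ} {a b : ℝ} (hab : a ≤ b)
    (hM : ContinuousOn M (Icc a b)) (z₀ : Fin n → ℝ) :
    ∃ z : ℝ → Fin n → ℝ, z a = z₀ ∧ IsSolutionOn (fun s y => M s *ᵥ y) a b z := by
  let Φ : Matrix (Fin n) (Fin n) ℝ →ₗ[ℝ] (Fin n → ℝ) →L[ℝ] (Fin n → ℝ) :=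
    LinearMap.toContinuousLinearMap.toLinearMap ∘ₗ (Matrix.toLin' (R := ℝ)).toLinearMap
  have hΦ : Continuous Φ := LinearMap.continuous_of_finiteDimensional Φ
  have hΦM : ContinuousOn (fun s => Φ (M s)) (Icc a b) := hΦ.comp_continuousOn hM
  obtain ⟨z, hz0, hz⟩ := exists_linear_ode_solution hab hΦM z₀
  have hzc : ContinuousOn z (Icc a b) := fun s hs => (hz s hs).continuousWithinAt
  refine ⟨z, hz0, absolutelyContinuousOnInterval_of_hasDerivWithinAt hab hz
    (hΦM.clm_apply hzc), Filter.Eventually.of_forall fun s hs => ?_⟩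
  exact (hz s (Ioo_subset_Icc_self hs)).hasDerivAt (Icc_mem_nhds hs.1 hs.2)

/-- The moving ellipsoid is contained in the backwards reachable set. -/
theorem IsEllipsoidFlow.ellipsoid_subset_backwardReachableSet
    (h : IsEllipsoidFlow T A B p P xe Xe S q Q) (hP : P.PosDef)
    (hA : ContinuousOn A (Icc 0 T)) (hB : ContinuousOn B (Icc 0 T))
    (hS : ContinuousOn S (Icc 0 T))
    (hSorth : ∀ t ∈ Icc 0 T, S t ∈ Matrix.orthogonalGroup (Fin n) ℝ) {t : ℝ}
    (ht : t ∈ Icc 0 T) :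
    ellipsoid (q t) (Q t) ⊆
      backwardReachableSet (ltvField A B) (ellipsoid p P) (ellipsoid xe Xe) T t := by
  intro x₀ hx₀
  have hsub : Icc t T ⊆ Icc 0 T := Icc_subset_Icc_left ht.1
  have hpd : ∀ s ∈ Icc t T, (Q s).PosDef := fun s hs => h.shape_posDef s (hsub hs)
  have hunit : ∀ s ∈ Icc t T, IsUnit (matSqrt (Q s)).det := fun s hs =>
    isUnit_det_matSqrt (hpd s hs)
  -- continuity of the coefficients
  have hAc := hA.mono hsub
  have hBc := hB.mono hsub
  have hSc := hS.mono hsub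
  have hQc : ContinuousOn Q (Icc t T) :=
    (h.continuousOn_shape (ht.1.trans ht.2)).mono hsub
  have hGc : ContinuousOn (fun s => matSqrt (Q s)) (Icc t T) :=
    continuousOn_matSqrt.comp hQc fun s hs => (hpd s hs).posSemidef
  have hGic : ContinuousOn (fun s => (matSqrt (Q s))⁻¹) (Icc t T) :=
    continuousOn_matrix_inv.comp hGc hunit
  let C : ℝ → Matrix (Fin n) (Fin m) ℝ := fun s => (matSqrt (Q s))⁻¹ * B s * matSqrt P
  have hmul : ∀ {j k l : ℕ} {M : ℝ → Matrix (Fin j) (Fin k) ℝ} {N : ℝ → Matrix (Fin k) (Fin l) ℝ},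
      ContinuousOn M (Icc t T) → ContinuousOn N (Icc t T) →
        ContinuousOn (fun s => M s * N s) (Icc t T) := fun hM hN => by
    rw [continuousOn_iff_continuous_domRestrict] at *
    exact hM.matrix_mul hN
  have hCc : ContinuousOn C (Icc t T) := hmul (hmul hGic hBc) continuousOn_const
  have hqs : ∀ s, qStar (B s) P (Q s) = C s * (C s)ᵀ := fun s =>
    qStar_eq_mul_transpose (B s) hP.posSemidef (Q s)
  have hHc : ContinuousOn (fun s => matSqrt (qStar (B s) P (Q s))) (Icc t T) := by
    refine continuousOn_matSqrt.comp ?_ fun s _ => qStar_posSemidef (B s) hP.posSemidef (Q s)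
    refine (hmul hCc (continuous_id.matrix_transpose.comp_continuousOn hCc)).congr
      fun s _ => hqs s
  -- the closed loop system
  let M : ℝ → Matrix (Fin n) (Fin n) ℝ := fun s =>
    A s - matSqrt (Q s) * (matSqrt (qStar (B s) P (Q s)) * (S s * (matSqrt (Q s))⁻¹))
  have hMc : ContinuousOn M (Icc t T) := hAc.sub (hmul hGc (hmul hHc (hmul hSc hGic)))
  -- The deviation `z = x - q` is found before any control; the control is then chosen to realise
  -- it.
  obtain ⟨z, hz0, hz⟩ := exists_matrix_ode_solution ht.2 hMc (x₀ - q t)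
  have hzc : ContinuousOn z (Icc t T) := by
    have := hz.1.continuousOn
    rwa [uIcc_of_le ht.2] at this
  have hrc : ContinuousOn (fun s => S s *ᵥ ((matSqrt (Q s))⁻¹ *ᵥ z s)) (Icc t T) := by
    rw [continuousOn_iff_continuous_domRestrict] at *
    exact hSc.matrix_mulVec (hGic.matrix_mulVec hzc)
  obtain ⟨w, hwm, hw⟩ := exists_measurable_minimal_solution hCc hrc
  -- Since `B P^{1/2} = Q^{1/2} C`, this `u` turns `C w = H S ŵ` into the required feedback.
  let u : ℝ → Fin m → ℝ := fun s => p - matSqrt P *ᵥ w s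
  let x : ℝ → Fin n → ℝ := fun s => q s + z s
  have hBu : ∀ s ∈ Icc t T, B s *ᵥ (u s - p) = -(matSqrt (Q s) *ᵥ
      (matSqrt (qStar (B s) P (Q s)) *ᵥ (S s *ᵥ ((matSqrt (Q s))⁻¹ *ᵥ z s)))) := by
    intro s hs
    rw [hqs, ← (hw s hs).1]
    simp only [u, C, sub_sub_cancel_left, Matrix.mulVec_neg, Matrix.mulVec_mulVec]
    rw [Matrix.mul_assoc (matSqrt (Q s))⁻¹, ← Matrix.mul_assoc (matSqrt (Q s)),
      Matrix.mul_nonsing_inv _ (hunit s hs), Matrix.one_mul]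
  have htraj : IsTrajectory (ltvField A B) t T u x := by
    refine ⟨(h.center_ode.1.mono (uIcc_subset_uIcc_of_mem ht)).add hz.1, ?_⟩
    filter_upwards [h.center_ode.2, hz.2] with s hq hzs hs
    refine ((hq ⟨ht.1.trans_lt hs.1, hs.2⟩).add (hzs hs)).congr_deriv ?_
    have h1 : B s *ᵥ u s = B s *ᵥ p + B s *ᵥ (u s - p) := by
      rw [← Matrix.mulVec_add, add_sub_cancel]
    simp only [ltvField, x, h1, hBu s (Ioo_subset_Icc_self hs), M, Matrix.sub_mulVec,
      Matrix.mulVec_add, ← Matrix.mulVec_mulVec]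
    abel
  have hxq : ∀ s, x s - q s = z s := fun s => add_sub_cancel_left _ _
  have hx0 : x t = x₀ := by simp [x, hz0]
  have hac := h.absolutelyContinuous_quadraticForm ht htraj.1
  -- the quadratic form is constant along the closed loop trajectory
  have hmem : ∀ s ∈ Icc t T, x s ∈ ellipsoid (q s) (Q s) := by
    intro s hs
    have hV := (hac.mono (c := t) (d := s) (by
      rw [uIcc_of_le hs.1, uIcc_of_le ht.2]
      exact Icc_subset_Icc_right hs.2)).eq_of_ae_deriv_eq_zero hs.1 (by
        filter_upwards [h.ae_hasDerivAt_quadraticForm ht htraj] with r hr hrs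
        have hrt : r ∈ Ioo t T := ⟨hrs.1, hrs.2.trans_le hs.2⟩
        have hrI := Ioo_subset_Icc_self hrt
        -- Moving `Q^{1/2}` and `H` across the product makes the input term `-2⟨Hŵ, Sŵ⟩`, the exact
        -- opposite of the other one.
        rw [(hr hrt).deriv, hBu r hrI, wHat, hxq, dotProduct_neg,
          Matrix.dotProduct_mulVec_transpose (matSqrt (Q r)), matSqrt_transpose,
          matSqrt_mulVec_inv_mulVec (hpd r hrI),
          Matrix.dotProduct_mulVec_transpose (matSqrt (qStar (B r) P (Q r))),
          matSqrt_transpose]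
        ring)
    change (x s - q s) ⬝ᵥ ((Q s)⁻¹ *ᵥ (x s - q s)) ≤ 1
    rw [← hV, hx0]
    exact hx₀
  refine ⟨u, ⟨?_, fun s hs => ?_⟩, x, htraj, hx0, ?_⟩
  · have hPw : Continuous fun v : Fin m → ℝ => p - matSqrt P *ᵥ v :=
      continuous_const.sub (continuous_const.matrix_mulVec continuous_id)
    exact hPw.measurable.comp hwm
  · rw [mem_ellipsoid_iff_norm2_wHat_le hP]
    have h1 : wHat p P (u s) = -w s := by
      simp only [wHat, u, sub_sub_cancel_left, Matrix.mulVec_neg, Matrix.mulVec_mulVec]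
      rw [Matrix.nonsing_inv_mul _ (isUnit_det_matSqrt hP), Matrix.one_mulVec]
    -- Orthogonality of `S` enters only here, giving `‖w‖ ≤ ‖Sŵ‖ = ‖ŵ‖ ≤ 1`.
    have h2 : (S s *ᵥ ((matSqrt (Q s))⁻¹ *ᵥ z s)) ⬝ᵥ (S s *ᵥ ((matSqrt (Q s))⁻¹ *ᵥ z s)) =
        norm2 (wHat (q s) (Q s) (x s)) * norm2 (wHat (q s) (Q s) (x s)) := by
      have hST := (Matrix.mem_orthogonalGroup_iff' (Fin n) ℝ).1 (hSorth s (hsub hs))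
      rw [Matrix.dotProduct_mulVec_transpose, Matrix.mulVec_mulVec, hST, Matrix.one_mulVec,
        norm2_mul_self, wHat, hxq]
    have h3 := (mem_ellipsoid_iff_norm2_wHat_le (hpd s hs)).1 (hmem s hs)
    have h4 := (hw s hs).2
    rw [h2, norm2_mul_self] at h4
    rw [← dotProduct_self_le_one_iff, h1, neg_dotProduct, dotProduct_neg, neg_neg]
    exact h4.trans ((dotProduct_self_le_one_iff _).2 h3)
  · have := hmem T (right_mem_Icc.2 ht.2)
    rwa [h.center_final, h.shape_final] at this

end EllipsoidalTube

theorem theorem5 {n m N : ℕ} (T : ℝ) (hT : 0 ≤ T)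
    (A : ℝ → Matrix (Fin n) (Fin n) ℝ) (hA : ContinuousOn A (Icc 0 T))
    (B : ℝ → Matrix (Fin n) (Fin m) ℝ) (hB : ContinuousOn B (Icc 0 T))
    (p : Fin m → ℝ) (P : Matrix (Fin m) (Fin m) ℝ) (hP : P.PosDef)
    (xe : Fin n → ℝ) (Xe : Matrix (Fin n) (Fin n) ℝ) (hXe : Xe.PosDef)
    (S : Fin N → ℝ → Matrix (Fin n) (Fin n) ℝ)
    (hScont : ∀ i, ContinuousOn (S i) (Icc 0 T))
    (hSorth : ∀ i, ∀ t ∈ Icc 0 T, S i t ∈ Matrix.orthogonalGroup (Fin n) ℝ)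
    (q : Fin N → ℝ → Fin n → ℝ) (Q : Fin N → ℝ → Matrix (Fin n) (Fin n) ℝ)
    (hflow : ∀ i, IsEllipsoidFlow T A B p P xe Xe (S i) (q i) (Q i)) :
    (∀ t ∈ Icc 0 T, ellipsoidUnion q Q t ⊆
      backwardReachableSet (ltvField A B) (ellipsoid p P) (ellipsoid xe Xe) T t) ∧
    (∀ t ∈ Icc 0 T, ∀ i : Fin N, ∀ u ∈ admissibleControls (ellipsoid p P) t T,
      ∀ x : ℝ → Fin n → ℝ, IsTrajectory (ltvField A B) t T u x → x T ∈ ellipsoid xe Xe →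
      IsAligned t T B P (S i) (q i) (Q i) x →
      ∀ s ∈ Icc t T, x s ∈ ellipsoid (q i s) (Q i s) ∧
        ellipsoid (q i s) (Q i s) ⊆ ellipsoidUnion q Q s) := by
  refine ⟨fun t ht => iUnion_subset fun i =>
    (hflow i).ellipsoid_subset_backwardReachableSet hP hA hB (hScont i) (hSorth i) ht, ?_⟩
  intro t ht i u hu x hx hxT hal s hs
  exact ⟨(hflow i).mem_ellipsoid_of_isAligned hP ht hu hx hxT hal hs,
    subset_iUnion (fun j => ellipsoid (q j s) (Q j s)) i⟩
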